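/- **The Magnetic Tower of Hanoi.** There are three posts, a Source $S$, an Intermediate post $I$ and a Destination $D$, and $N$ disks of different sizes, numbered from the largest (disk $1$) to the smallest (disk $N$). One side of each disk is Red and the other Blue. Each post is pre-coloured Red ($R$), Blue ($B$) or Neutral ($N$); a pre-colouring is written in the order $(S,I,D)$, e.g. $RBN$. A move takes the top disk of a post, turns it over and puts it on another post, subject to: (Size Rule) a disk is never placed on a smaller one; (Magnetic Rule) touching sides of disks have opposite colours, so that the moved disk, after turning over, shows the same colour as the disks it lands on; and a post pre-coloured Red (Blue) only takes disks that show Red (Blue), while an empty Neutral post takes either colour. At the start all $N$ disks are on $S$, Red side up; the puzzle is solved when all $N$ disks are on $D$, Blue side up. A sequence of legal moves that solves the puzzle is *optimal* if no solving sequence has fewer moves. **The algorithms.** $A(n;s,d,i)$ moves the $n$ smallest disks from post $s$ to post $d$ using post $i$; it is the empty sequence for $n=0$. With $j=N+1-n$ the largest of these disks, and $(k:x\to y)$ a move of disk $k$ from $x$ to $y$, the six algorithms are, for $n\ge 1$, - $SRBB_{1000}(n;s,d,i)$: $SRBB_{1000}(n-1;s,i,d)$, $(j:s\to d)$, $SRRB_{1000}(n-1;i,s,d)$,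 $SRBB_{1000}(n-1;s,d,i)$; - $SRRB_{1000}(n;s,d,i)$: $SRRB_{1000}(n-1;s,d,i)$, $SRBB_{1000}(n-1;d,i,s)$, $(j:s\to d)$, $SRRB_{1000}(n-1;i,d,s)$; - $SRBN_{909}(n;s,d,i)$: $SRNB_{727}(n-1;s,i,d)$, $(j:s\to d)$, $SRRB_{1000}(n-1;i,s,d)$, $SRBB_{1000}(n-1;s,d,i)$; - $SNRB_{909}(n;s,d,i)$: $SRRB_{1000}(n-1;s,d,i)$, $SRBB_{1000}(n-1;d,i,s)$, $(j:s\to d)$, $SBNR_{727}(n-1;i,d,s)$; - $SRNB_{727}(1;s,d,i)$ and $SBNR_{727}(1;s,d,i)$: $(j:s\to d)$; and for $n\ge2$ - $SRNB_{727}(n;s,d,i)$: $SRBN_{909}(n-1;s,i,d)$, $(j:s\to d)$, $SRRB_{1000}(n-2;i,s,d)$, $SRBB_{1000}(n-2;s,d,i)$, $(j+1:i\to s)$, $SRBN_{909}(n-2;d,i,s)$, $(j+1:s\to d)$, $SNRB_{909}(n-2;i,d,s)$; - $SBNR_{727}(n;s,d,i)$: $SRBN_{909}(n-2;s,i,d)$,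 $(j+1:s\to d)$, $SNRB_{909}(n-2;i,s,d)$, $(j+1:d\to i)$, $SRRB_{1000}(n-2;s,d,i)$, $SRBB_{1000}(n-2;d,i,s)$, $(j:s\to d)$, $SNRB_{909}(n-1;i,d,s)$. An algorithm is applied to the whole tower as $A(N;S,D,I)$. Let $S_{1000}(N)$, $S_{909}(N)$, $S_{727}(N)$ be the total number of moves made for $N$ disks by $SRBB_{1000}$, $SRBN_{909}$, $SRNB_{727}$, and let $P_{1000}(k)$, $P_{909}(k)$, $P_{727}(k)$ be the number of moves of disk $k$ in these algorithms for $k$ disks. **Theorem.** 1. For every $N$, $SRBN_{909}$ solves the $N$-disk puzzle with pre-colouring $RBN$ optimally, $SNRB_{909}$ solves the one with pre-colouring $NRB$ optimally, and both $SRNB_{727}$ and $SBNR_{727}$ solve the one with pre-colouring $RNB$ optimally. 2. For every $N$, the total number of moves for $N$ disks is $S_{1000}(N)$ for $SRRB_{1000}$, $S_{909}(N)$ for $SNRB_{909}$ and $S_{727}(N)$ for $SBNR_{727}$. For $1\le k\le N$, the number of moves of disk $k$ for $N$ disks is $P_{1000}(k)$ for both "1000" algorithms, $P_{909}(k)$ for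 both "909" algorithms and $P_{727}(k)$ for both "727" algorithms; in particular it does not depend on $N$. 3. $S_{909}(1)=1$ and $S_{909}(N+1)=S_{727}(N)+2S_{1000}(N)+1$ for $N\ge 0$; $P_{909}(1)=1$ and $P_{909}(k+1)=P_{727}(k)+2P_{1000}(k)$ for $k\ge1$. 4. $S_{727}(1)=1$, $S_{727}(2)=4$ and $S_{727}(N+1)=S_{909}(N)+2S_{909}(N-1)+2S_{1000}(N-1)+3$ for $N\ge1$; $P_{727}(1)=1$, $P_{727}(2)=3$ and $P_{727}(k+1)=P_{909}(k)+2P_{909}(k-1)+2P_{1000}(k-1)$ for $k\ge2$. 5. As $N\to\infty$, $S_{909}(N)/S_{1000}(N)\to 10/11$ and $S_{727}(N)/S_{1000}(N)\to 8/11$; as $k\to\infty$, $P_{909}(k)/P_{1000}(k)\to 10/11$ and $P_{727}(k)/P_{1000}(k)\to 8/11$. -/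

import Mathlib

open Filter Topology

namespace MToH

/-- The two sides of a disk. -/
inductive Colour
  | red
  | blue
  deriving DecidableEq

/-- Turning a disk over. -/
def Colour.flip : Colour → Colour
  | .red => .blue
  | .blue => .red

/-- The three posts: Source, Intermediate, Destination. -/
inductive Post
  | S
  | I
  | D
  deriving DecidableEq

/-- A pre-colouring: a post is permanently red, permanently blue, or neutral (`none`). -/
abbrev PreColouring := Post → Option Colour

/-- The pre-colouring written as a three letter word in the order Source, Intermediate,
Destination. -/
def preColouring (s i d : Option Colour) : PreColouring
  | .S => s
  | .I => i
  | .D => d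

/-- (S, I, D) = (Red, Blue, Neutral). -/
def RBN : PreColouring := preColouring (some .red) (some .blue) none

/-- (S, I, D) = (Neutral, Red, Blue). -/
def NRB : PreColouring := preColouring none (some .red) (some .blue)

/-- (S, I, D) = (Red, Neutral, Blue). -/
def RNB : PreColouring := preColouring (some .red) none (some .blue)

/-- Where a disk is and which of its sides faces up. -/
structure DiskState where
  post : Post
  up : Colour

/-- A state of the tower with `N` disks. Disks are numbered from the largest (disk `1`) to the
smallest (disk `N`); the index `k : Fin N` stands for disk number `k + 1`. On each post the disks
are stacked in order of size, the smallest on top. -/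
abbrev Tower (N : ℕ) := Fin N → DiskState

/-- All disks on the Source post, red side up. -/
def start (N : ℕ) : Tower N := fun _ => ⟨.S, .red⟩

/-- All disks on the Destination post, blue side up. -/
def goal (N : ℕ) : Tower N := fun _ => ⟨.D, .blue⟩

/-- The rules under which disk `k` may be taken, turned over and put on post `q`. -/
structure Legal {N : ℕ} (pre : PreColouring) (c : Tower N) (k : Fin N) (q : Post) : Prop where
  /-- the disk goes to another post -/
  ne : (c k).post ≠ q
  /-- only the top disk of a post can be moved -/
  top : ∀ l, k < l → (c l).post ≠ (c k).post
  /-- size rule: no disk on the target post is smaller -/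
  size : ∀ l, k < l → (c l).post ≠ q
  /-- magnetic rule: touching sides must have opposite colours, that is, the moved disk shows,
  after turning over, the same colour as the disks that it lands on -/
  magnetic : ∀ l, (c l).post = q → (c l).up = (c k).up.flip
  /-- a pre-coloured post only takes disks that show the colour of the post -/
  base : ∀ x, pre q = some x → (c k).up.flip = x

/-- `move(disk, src, dst)`. -/
structure Move where
  disk : ℕ
  src : Post
  dst : Post

/-- The move `m` is legal in state `c` and leads to the state `c'`. -/
def Step {N : ℕ} (pre : PreColouring) (c : Tower N) (m : Move) (c' : Tower N) : Prop :=
  ∃ k : Fin N, m.disk = k + 1 ∧ (c k).post = m.src ∧ Legal pre c k m.dst ∧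
    c' = Function.update c k ⟨m.dst, (c k).up.flip⟩

/-- The sequence of moves is legal from state `c` on and leads to the state `c'`. -/
def Run {N : ℕ} (pre : PreColouring) : Tower N → List Move → Tower N → Prop
  | c, [], c' => c = c'
  | c, m :: ms, c' => ∃ c₁, Step pre c m c₁ ∧ Run pre c₁ ms c'

/-- The sequence of moves solves the `N`-disk puzzle. -/
def Solves (pre : PreColouring) (N : ℕ) (ms : List Move) : Prop :=
  Run pre (start N) ms (goal N)

/-- The sequence of moves solves the `N`-disk puzzle, and no solution has fewer moves. -/
def IsOptimal (pre : PreColouring) (N : ℕ) (ms : List Move) : Prop :=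
  Solves pre N ms ∧ ∀ ms', Solves pre N ms' → ms.length ≤ ms'.length

/- The algorithms. In each of them `N` is the total number of disks, and the `n` smallest disks,
`N + 1 - n, …, N`, are moved from post `s` to post `d` with the help of post `i`. -/

mutual

/-- The algorithm of the "1000" pair for the colouring (R, B, B) of the posts (s, i, d). -/
def SRBB1000 (N : ℕ) : ℕ → Post → Post → Post → List Move
  | 0, _, _, _ => []
  | n + 1, s, d, i =>
      SRBB1000 N n s i d ++
      [⟨N + 1 - (n + 1), s, d⟩] ++
      SRRB1000 N n i s d ++
      SRBB1000 N n s d i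

/-- The algorithm of the "1000" pair for the colouring (R, R, B) of the posts (s, i, d). -/
def SRRB1000 (N : ℕ) : ℕ → Post → Post → Post → List Move
  | 0, _, _, _ => []
  | n + 1, s, d, i =>
      SRRB1000 N n s d i ++
      SRBB1000 N n d i s ++
      [⟨N + 1 - (n + 1), s, d⟩] ++
      SRRB1000 N n i d s

end

mutual

/-- The algorithm of the "909" pair for the colouring (R, B, N) of the posts (s, i, d). -/
def SRBN909 (N : ℕ) : ℕ → Post → Post → Post → List Move
  | 0, _, _, _ => []
  | n + 1, s, d, i =>
      SRNB727 N n s i d ++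
      [⟨N + 1 - (n + 1), s, d⟩] ++
      SRRB1000 N n i s d ++
      SRBB1000 N n s d i

/-- The algorithm of the "909" pair for the colouring (N, R, B) of the posts (s, i, d). -/
def SNRB909 (N : ℕ) : ℕ → Post → Post → Post → List Move
  | 0, _, _, _ => []
  | n + 1, s, d, i =>
      SRRB1000 N n s d i ++
      SRBB1000 N n d i s ++
      [⟨N + 1 - (n + 1), s, d⟩] ++
      SBNR727 N n i d s

/-- The first algorithm of the "727" pair, for the colouring (R, N, B) of the posts (s, i, d). -/
def SRNB727 (N : ℕ) : ℕ → Post → Post → Post → List Move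
  | 0, _, _, _ => []
  | 1, s, d, _ => [⟨N + 1 - 1, s, d⟩]
  | n + 2, s, d, i =>
      SRBN909 N (n + 1) s i d ++
      [⟨N + 1 - (n + 2), s, d⟩] ++
      SRRB1000 N n i s d ++
      SRBB1000 N n s d i ++
      [⟨N + 1 - (n + 2) + 1, i, s⟩] ++
      SRBN909 N n d i s ++
      [⟨N + 1 - (n + 2) + 1, s, d⟩] ++
      SNRB909 N n i d s

/-- The second algorithm of the "727" pair (the time reversal of the first one), also for the
colouring (R, N, B) of the posts (s, i, d). -/
def SBNR727 (N : ℕ) : ℕ → Post → Post → Post → List Move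
  | 0, _, _, _ => []
  | 1, s, d, _ => [⟨N + 1 - 1, s, d⟩]
  | n + 2, s, d, i =>
      SRBN909 N n s i d ++
      [⟨N + 1 - (n + 2) + 1, s, d⟩] ++
      SNRB909 N n i s d ++
      [⟨N + 1 - (n + 2) + 1, d, i⟩] ++
      SRRB1000 N n s d i ++
      SRBB1000 N n d i s ++
      [⟨N + 1 - (n + 2), s, d⟩] ++
      SNRB909 N (n + 1) i d s

end

/-- The moves that an algorithm makes for the whole tower of `N` disks. -/
def solution (alg : ℕ → ℕ → Post → Post → Post → List Move) (N : ℕ) : List Move :=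
  alg N N .S .D .I

/-- The number of moves of disk number `k` in a sequence of moves. -/
def diskMoves (ms : List Move) (k : ℕ) : ℕ := ms.countP (fun m => m.disk = k)

/-- Total number of moves of the "1000" algorithm for `N` disks. -/
def S1000 (N : ℕ) : ℕ := (solution SRBB1000 N).length

/-- Total number of moves of the "909" algorithm for `N` disks. -/
def S909 (N : ℕ) : ℕ := (solution SRBN909 N).length

/-- Total number of moves of the "727" algorithm for `N` disks. -/
def S727 (N : ℕ) : ℕ := (solution SRNB727 N).length

/-- Number of moves of disk `k` in the "1000" algorithm (for a tower of `k` disks). -/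
def P1000 (k : ℕ) : ℕ := diskMoves (solution SRBB1000 k) k

/-- Number of moves of disk `k` in the "909" algorithm (for a tower of `k` disks). -/
def P909 (k : ℕ) : ℕ := diskMoves (solution SRBN909 k) k

/-- Number of moves of disk `k` in the "727" algorithm (for a tower of `k` disks). -/
def P727 (k : ℕ) : ℕ := diskMoves (solution SRNB727 k) k

end MToH

/-!
Why the algorithms are optimal. Let `ν` be the neutral post, `p` the post of colour `x` and `q` the
post of the other colour `flip x`. A coloured post determines the colour of its disks, so a disk has
only the four states `(ν, flip x)`, `(p, x)`, `(q, flip x)`, `(ν, x)`. A move changes the colour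
and the post, so it leads from a state to a neighbour in this list. When the largest disk moves, all
others are on the third post. Leaving out the moves of the largest disk turns a legal sequence of
moves into a legal sequence for the smaller disks, and as long as the largest disk lies on `ν`
showing a colour, the smaller disks see `ν` as a post of that colour. Cutting a sequence of moves at
the time when the largest disk first leaves a set of states (`Run.exists_first_exit`) thus bounds
its length below by the lengths of two sequences for the smaller disks. This gives lower bounds, by
simultaneous induction on the number of disks, for three kinds of transport (`far_neutral`):

* `ν` to the post of the opposite colour: the smaller disks first go from `ν` to `p`, where `ν`
  counts as coloured like `p` (`far_linear`), and then from `p` to `q`;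
* `p` to `q`: at a step of the largest disk from `p` to `q` the smaller disks are on `ν`; whatever
  colour they show there, one of `p` and `q` has the same colour and the other one the opposite;
* `ν` to the post `p` of the same colour: the largest disk has to pass through `q`, so the smaller
  disks go from `ν`, which counts as coloured at that time, to `p`, then to `ν` and back to `p`.

The bounds satisfy the recurrences for the lengths of the algorithms. Transports in the opposite
direction cost the same, since legal moves can be taken back (`Step.reverse`).

The algorithms are legal (`run_1000`, `run_neutral`) because each recursive call only needs its
posts to accept the smaller disks in the right colours; a neutral post with a larger disk on it
accepts one colour, and without one both. The counts of moves follow the recursions of the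
algorithms. The solutions of the two linear recurrences are multiples of `3 ^ n` up to an error of
the order of `2 ^ n`, which gives the limits (`tendsto_div_three_pow`).
-/

namespace MToH

/-! ### Runs of legal moves -/

@[simp] lemma Colour.flip_flip (x : Colour) : x.flip.flip = x := by cases x <;> rfl

lemma Colour.flip_ne (x : Colour) : x.flip ≠ x := by cases x <;> simp [Colour.flip]

lemma Colour.eq_or_eq_flip (x y : Colour) : y = x ∨ y = x.flip := by
  cases x <;> cases y <;> simp [Colour.flip]

lemma Post.eq_third {p q r : Post} (hpq : p ≠ q) (hpr : p ≠ r) (hqr : q ≠ r) (z : Post) :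
    z = p ∨ z = q ∨ z = r := by
  cases p <;> cases q <;> cases r <;> cases z <;> simp_all

lemma Run.append {N : ℕ} {pre : PreColouring} {ms ms' : List Move} {c c₁ c' : Tower N}
    (h : Run pre c ms c₁) (h' : Run pre c₁ ms' c') : Run pre c (ms ++ ms') c' := by
  induction ms generalizing c with
  | nil => exact (show c = c₁ from h) ▸ h'
  | cons m ms ih =>
    obtain ⟨a, h1, h2⟩ := h
    exact ⟨a, h1, ih h2⟩

lemma run_singleton {N : ℕ} {pre : PreColouring} {m : Move} {c c' : Tower N} :
    Run pre c [m] c' ↔ Step pre c m c' := by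
  simp [Run]

/-- The colourings of the disks that can occur in play: the disks on a post all show the same
colour, and on a pre-coloured post it is the colour of the post. -/
structure Valid {N : ℕ} (pre : PreColouring) (c : Tower N) : Prop where
  same : ∀ k l, (c k).post = (c l).post → (c k).up = (c l).up
  base : ∀ k x, pre (c k).post = some x → (c k).up = x

lemma Valid.step {N : ℕ} {pre : PreColouring} {c c' : Tower N} {m : Move}
    (hc : Valid pre c) (h : Step pre c m c') : Valid pre c' := by
  obtain ⟨k, -, -, hl, rfl⟩ := h
  refine ⟨fun a b => ?_, fun a x => ?_⟩
  · by_cases ha : a = k <;> by_cases hb : b = k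
    · simp [ha, hb]
    · subst ha
      simp only [Function.update_self, Function.update_of_ne hb]
      exact fun h => (hl.magnetic b h.symm).symm
    · subst hb
      simp only [Function.update_self, Function.update_of_ne ha]
      exact fun h => hl.magnetic a h
    · simp only [Function.update_of_ne ha, Function.update_of_ne hb]
      exact hc.same a b
  · by_cases ha : a = k
    · subst ha
      simp only [Function.update_self]
      exact hl.base x
    · simp only [Function.update_of_ne ha]
      exact hc.base a x

/-- A legal move can be taken back: in a valid state the disks that the moved disk has left behind
show the colour that it takes again on its return. -/
lemma Step.reverse {N : ℕ} {pre : PreColouring} {c c' : Tower N} {m : Move}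
    (hc : Valid pre c) (h : Step pre c m c') : Step pre c' ⟨m.disk, m.dst, m.src⟩ c := by
  obtain ⟨k, hk, hs, hl, rfl⟩ := h
  have hne : ∀ l, k < l → l ≠ k := fun l h => h.ne'
  refine ⟨k, hk, by simp, ⟨?_, fun l h => ?_, fun l h => ?_, fun l h => ?_, fun x h => ?_⟩, ?_⟩
  · simpa [← hs] using hl.ne.symm
  · simpa [Function.update_of_ne (hne l h)] using hl.size l h
  · simpa [Function.update_of_ne (hne l h), ← hs] using hl.top l h
  · by_cases hlk : l = k
    · subst hlk
      simp only [Function.update_self] at h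
      exact absurd (hs.trans h.symm) hl.ne
    · simp only [Function.update_of_ne hlk] at h ⊢
      simpa using hc.same l k (h.trans hs.symm)
  · simpa using hc.base k x (hs ▸ h)
  · simp [← hs]

/-- `n` is a lower bound for the number of moves from `c` to `c'`. -/
def Far {N : ℕ} (pre : PreColouring) (c c' : Tower N) (n : ℕ) : Prop :=
  ∀ ms, Run pre c ms c' → n ≤ ms.length

lemma Run.reverse {N : ℕ} {pre : PreColouring} {ms : List Move} {c c' : Tower N}
    (hc : Valid pre c) (h : Run pre c ms c') :
    ∃ ms', Run pre c' ms' c ∧ ms'.length = ms.length := by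
  induction ms generalizing c with
  | nil => exact ⟨[], h.symm, rfl⟩
  | cons m ms ih =>
    obtain ⟨c₁, h1, h2⟩ := h
    obtain ⟨l, hl, hlen⟩ := ih (hc.step h1) h2
    exact ⟨l ++ [⟨m.disk, m.dst, m.src⟩],
      hl.append (run_singleton.2 (h1.reverse hc)), by simp [hlen]⟩

lemma Far.symm {N : ℕ} {pre : PreColouring} {c c' : Tower N} {n : ℕ} (h : Far pre c c' n)
    (hc' : Valid pre c') : Far pre c' c n := by
  intro ms hms
  obtain ⟨l, hl, hlen⟩ := hms.reverse hc'
  exact hlen ▸ h l hl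

/-- All disks on the post `p`, showing the colour `x`. -/
def tower (N : ℕ) (p : Post) (x : Colour) : Tower N := fun _ => ⟨p, x⟩

lemma valid_tower {N : ℕ} {pre : PreColouring} {p : Post} {x : Colour}
    (h : ∀ y, pre p = some y → x = y) : Valid pre (tower N p x) :=
  ⟨fun _ _ _ => rfl, fun _ y hy => h y hy⟩

/-! ### Forgetting the largest disk -/

/-- Without the largest disk `0` a legal sequence of moves stays legal, up to the time of the first
move that takes the largest disk out of the set `Q` of its states. The smaller disks may even be
held to a stricter pre-colouring `pre'`, if the largest disk enforces it by its presence. -/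
lemma Run.exists_first_exit {N : ℕ} {pre pre' : PreColouring} {Q : DiskState → Prop}
    (hQ : ∀ z p y, Q z → pre' p = some y → pre p = some y ∨ z = ⟨p, y⟩)
    {ms : List Move} {c c' : Tower (N + 1)} (hc : Valid pre c) (h : Run pre c ms c')
    (h0 : Q (c 0)) (h1 : ¬ Q (c' 0)) :
    ∃ (l₁ l₂ : List Move) (c₁ : Tower (N + 1)) (q : Post),
      Run pre' (Fin.tail c) l₁ (Fin.tail c₁) ∧ Valid pre c₁ ∧ Q (c₁ 0) ∧ Legal pre c₁ 0 q ∧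
      ¬ Q ⟨q, (c₁ 0).up.flip⟩ ∧ Run pre (Function.update c₁ 0 ⟨q, (c₁ 0).up.flip⟩) l₂ c' ∧
      l₁.length + 1 + l₂.length ≤ ms.length := by
  induction ms generalizing c with
  | nil => exact absurd (h ▸ h0) h1
  | cons m ms ih =>
    obtain ⟨c₂, hs, hr⟩ := h
    have hc₂ := hc.step hs
    by_cases h2 : Q (c₂ 0)
    · obtain ⟨l₁, l₂, c₁, q, a1, a2, a3, a4, a5, a6, a7⟩ := ih hc₂ hr h2
      obtain ⟨k, hk, hsrc, hl, rfl⟩ := hs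
      induction k using Fin.cases with
      | zero =>
        refine ⟨l₁, l₂, c₁, q, ?_, a2, a3, a4, a5, a6, by simp; omega⟩
        simpa [Fin.tail_update_zero] using a1
      | succ k =>
        -- without the largest disk, all disk numbers are smaller by one
        refine ⟨⟨m.disk - 1, m.src, m.dst⟩ :: l₁, l₂, c₁, q, ⟨_, ?_, a1⟩, a2, a3, a4, a5, a6,
          by simp; omega⟩
        refine ⟨k, by simp [hk], hsrc, ⟨hl.ne, fun l h => hl.top l.succ (by simpa using h),
          fun l h => hl.size l.succ (by simpa using h), fun l h => hl.magnetic l.succ h,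
          fun x hx => ?_⟩, by simp [Fin.tail_update_succ, Fin.tail]⟩
        rcases hQ _ _ _ h0 hx with h | h
        · exact hl.base x h
        · have := hl.magnetic 0 (by rw [h])
          rw [h] at this
          exact this.symm
    · obtain ⟨k, hk, hsrc, hl, rfl⟩ := hs
      induction k using Fin.cases with
      | zero =>
        exact ⟨[], ms, c, m.dst, rfl, hc, h0, hl, by simpa using h2, hr, by simp; omega⟩
      | succ k =>
        exact absurd (by simpa [Function.update_of_ne (Fin.succ_ne_zero k).symm] using h0) h2

/-- The smaller disks play by the same rules as the whole tower, so every sequence of moves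
contains one for them alone. -/
lemma Run.tail {N : ℕ} {pre : PreColouring} {ms : List Move} {c c' : Tower (N + 1)}
    (h : Run pre c ms c') :
    ∃ ms', Run pre (Fin.tail c) ms' (Fin.tail c') ∧ ms'.length ≤ ms.length := by
  induction ms generalizing c with
  | nil => exact ⟨[], by rw [show c = c' from h]; rfl, le_rfl⟩
  | cons m ms ih =>
    obtain ⟨c₂, ⟨k, hk, hsrc, hl, rfl⟩, hr⟩ := h
    obtain ⟨l, h1, h2⟩ := ih hr
    induction k using Fin.cases with
    | zero => exact ⟨l, by simpa [Fin.tail_update_zero] using h1, by simp; omega⟩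
    | succ k =>
      refine ⟨⟨m.disk - 1, m.src, m.dst⟩ :: l, ⟨_, ?_, h1⟩, by simpa using h2⟩
      exact ⟨k, by simp [hk], hsrc, ⟨hl.ne, fun l h => hl.top l.succ (by simpa using h),
        fun l h => hl.size l.succ (by simpa using h), fun l h => hl.magnetic l.succ h,
        hl.base⟩, by simp [Fin.tail_update_succ, Fin.tail]⟩

/-- When the largest disk moves, all other disks are on the third post. -/
lemma Legal.tail_eq_tower {N : ℕ} {pre : PreColouring} {c : Tower (N + 1)} {q r : Post}
    (hc : Valid pre c) (h : Legal pre c 0 q) (hr : r ≠ (c 0).post) (hq : r ≠ q) :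
    ∃ y, Fin.tail c = tower N r y ∧ ∀ x, pre r = some x → y = x := by
  have hpost : ∀ k : Fin N, (c k.succ).post = r := fun k =>
    ((Post.eq_third h.ne hr.symm hq.symm (c k.succ).post).resolve_left
      (h.top _ k.succ_pos)).resolve_left (h.size _ k.succ_pos)
  rcases N with _ | N
  · -- with no other disks, any colour will do that the post admits
    refine ⟨(pre r).getD .red, by ext k; exact k.elim0, fun x hx => by simp [hx]⟩
  · refine ⟨(c (Fin.succ 0)).up, ?_, fun x hx => hc.base _ x (by rw [hpost]; exact hx)⟩
    funext k
    have h1 := hpost k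
    have h2 := hc.same k.succ (Fin.succ 0) (by rw [hpost, hpost])
    change c k.succ = _
    rw [← h1, ← h2]
    rfl

@[simp] lemma tail_tower (N : ℕ) (p : Post) (x : Colour) :
    Fin.tail (tower (N + 1) p x) = tower N p x := rfl

/-! ### Lower bounds -/

/-- The number of moves of the "1000" algorithms for `n` disks. -/
def len1000 : ℕ → ℕ
  | 0 => 0
  | n + 1 => 3 * len1000 n + 1

mutual

/-- The number of moves of the "909" algorithms for `n` disks. -/
def len909 : ℕ → ℕ
  | 0 => 0
  | n + 1 => len727 n + 2 * len1000 n + 1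

/-- The number of moves of the "727" algorithms for `n` disks. -/
def len727 : ℕ → ℕ
  | 0 => 0
  | 1 => 1
  | n + 2 => len909 (n + 1) + 2 * len909 n + 2 * len1000 n + 3

end

/-- With all posts coloured, two of them alike, every move involves the third one. To carry a tower
between the two like posts, the largest disk has to step on the third post and off again, each time
with all smaller disks out of the way. -/
lemma far_linear {pre : PreColouring} {p q r : Post} {x : Colour} (hp : pre p = some x)
    (hr : pre r = some x) (hq : pre q = some x.flip) (hpr : p ≠ r) (N : ℕ) :
    Far pre (tower N p x) (tower N r x) (2 * len1000 N) := by
  have hpq : p ≠ q := by rintro rfl; exact x.flip_ne (by simpa [hp] using hq.symm)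
  have hrq : r ≠ q := by rintro rfl; exact x.flip_ne (by simpa [hr] using hq.symm)
  have hvp : ∀ N, Valid pre (tower N p x) := fun N => valid_tower (by simp [hp])
  have hvr : ∀ N, Valid pre (tower N r x) := fun N => valid_tower (by simp [hr])
  induction N with
  | zero => intro ms _; simp [len1000]
  | succ N ih =>
    intro ms h
    -- the first departure of the largest disk from `p`
    obtain ⟨l₁, l₂, c₁, q₁, a1, a2, a3, a4, a5, a6, a7⟩ :=
      h.exists_first_exit (pre' := pre) (Q := fun z => z = ⟨p, x⟩) (fun _ _ _ _ h => .inl h)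
        (hvp _) rfl (by simp [tower, hpr.symm])
    rw [a3] at a5 a6
    have hq₁ : q₁ = q := by
      rcases Post.eq_third hpr hpq hrq q₁ with rfl | rfl | rfl
      · exact absurd (by rw [a3]) a4.ne
      · exact absurd (by simpa [a3] using a4.base x hr) x.flip_ne
      · rfl
    subst hq₁
    obtain ⟨y, hy, hyx⟩ := a4.tail_eq_tower (r := r) a2 (by rw [a3]; exact hpr.symm) hrq
    rw [hyx x hr] at hy
    have hv : Valid pre (Function.update c₁ 0 ⟨q₁, x.flip⟩) := by
      obtain ⟨b, hb⟩ : ∃ m, Step pre c₁ m (Function.update c₁ 0 ⟨q₁, x.flip⟩) :=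
        ⟨⟨1, p, q₁⟩, 0, rfl, by rw [a3], a4, by rw [a3]⟩
      exact a2.step hb
    -- the first arrival of the largest disk at `r`
    obtain ⟨l₃, l₄, c₂, q₂, b1, b2, b3, b4, b5, b6, b7⟩ :=
      a6.exists_first_exit (pre' := pre) (Q := fun z => z.post ≠ r) (fun _ _ _ _ h => .inl h)
        hv (by simpa using hrq.symm) (by simp [tower])
    obtain rfl : q₂ = r := by simpa using b5
    have hc₂ : (c₂ 0).post = q₁ := by
      rcases Post.eq_third hpr hpq hrq (c₂ 0).post with h | h | h
      · have h1 := b2.base 0 x (by rw [h]; exact hp)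
        have h2 := b4.base x hr
        rw [h1] at h2
        exact absurd h2 x.flip_ne
      · exact absurd h b3
      · exact h
    obtain ⟨z, hz, hzx⟩ := b4.tail_eq_tower (r := p) b2 (by rw [hc₂]; exact hpq) hpr
    rw [hzx x hp] at hz
    obtain ⟨l₅, d1, d2⟩ := b6.tail
    simp only [Fin.tail_update_zero, hy, hz, tail_tower] at a1 b1 d1
    have e1 := ih _ a1
    have e2 := ih.symm (hvr N) _ b1
    have e3 := ih _ d1
    simp only [len1000]
    omega

/-- With `ν` neutral, the largest disk can only pass between the four states `(ν, flip x)`,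
`(p, x)`, `(q, flip x)`, `(ν, x)` in this order. When it takes the middle step, all smaller disks
are on `ν`. -/
lemma Run.exists_crossing {N : ℕ} {pre : PreColouring} {p q ν : Post} {x : Colour}
    (hp : pre p = some x) (hq : pre q = some x.flip) (hν : pre ν = none) {ms : List Move}
    {c c' : Tower (N + 1)} (hc : Valid pre c) (h : Run pre c ms c')
    (h0 : c 0 = ⟨p, x⟩ ∨ c 0 = ⟨ν, x.flip⟩) (h1 : ¬ (c' 0 = ⟨p, x⟩ ∨ c' 0 = ⟨ν, x.flip⟩)) :
    ∃ y l₁ l₂, Run pre (Fin.tail c) l₁ (tower N ν y) ∧ Run pre (tower N ν y) l₂ (Fin.tail c') ∧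
      l₁.length + 1 + l₂.length ≤ ms.length := by
  have hpq : p ≠ q := by rintro rfl; exact x.flip_ne (by simpa [hp] using hq.symm)
  have hpν : p ≠ ν := by rintro rfl; simp [hp] at hν
  have hqν : q ≠ ν := by rintro rfl; simp [hq] at hν
  obtain ⟨l₁, l₂, c₁, q₁, a1, a2, a3, a4, a5, a6, a7⟩ :=
    h.exists_first_exit (pre' := pre) (Q := fun z => z = ⟨p, x⟩ ∨ z = ⟨ν, x.flip⟩)
      (fun _ _ _ _ h => .inl h) hc h0 h1
  obtain ⟨hc₁, rfl⟩ : (c₁ 0).post = p ∧ q₁ = q := by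
    rcases a3 with a3 | a3 <;> rw [a3] at a5 <;>
      rcases Post.eq_third hpq hpν hqν q₁ with rfl | rfl | rfl
    · exact absurd (by rw [a3]) a4.ne
    · exact ⟨by rw [a3], rfl⟩
    · simp at a5
    · simp at a5
    · exact absurd (by simpa [a3] using a4.base _ hq) x.flip_ne.symm
    · exact absurd (by rw [a3]) a4.ne
  obtain ⟨y, hy, -⟩ := a4.tail_eq_tower (r := ν) a2 (by rw [hc₁]; exact hpν.symm) hqν.symm
  obtain ⟨l₃, d1, d2⟩ := a6.tail
  rw [Fin.tail_update_zero, hy] at d1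
  exact ⟨y, l₁, l₃, hy ▸ a1, d1, by omega⟩

/-- As long as the largest disk stays on the neutral post, showing `x`, this post is a post of
colour `x` for the smaller disks. -/
lemma Run.exists_leave_neutral {N : ℕ} {pre : PreColouring} {p q ν : Post} {x : Colour}
    (hp : pre p = some x) (hq : pre q = some x.flip) (hν : pre ν = none) {ms : List Move}
    {c c' : Tower (N + 1)} (hc : Valid pre c) (h : Run pre c ms c')
    (h0 : c 0 = ⟨ν, x⟩) (h1 : c' 0 ≠ ⟨ν, x⟩) :
    ∃ l₁ l₂ c₁, Run (Function.update pre ν (some x)) (Fin.tail c) l₁ (tower N p x) ∧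
      Valid pre c₁ ∧ c₁ 0 = ⟨q, x.flip⟩ ∧ Fin.tail c₁ = tower N p x ∧ Run pre c₁ l₂ c' ∧
      l₁.length + 1 + l₂.length ≤ ms.length := by
  have hpq : p ≠ q := by rintro rfl; exact x.flip_ne (by simpa [hp] using hq.symm)
  have hpν : p ≠ ν := by rintro rfl; simp [hp] at hν
  have hqν : q ≠ ν := by rintro rfl; simp [hq] at hν
  obtain ⟨l₁, l₂, c₁, q₁, a1, a2, a3, a4, a5, a6, a7⟩ :=
    h.exists_first_exit (pre' := Function.update pre ν (some x)) (Q := fun z => z = ⟨ν, x⟩)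
      (by
        rintro z r y rfl hy
        by_cases hr : r = ν
        · subst hr
          right
          simpa using hy
        · left
          simpa [Function.update_of_ne hr] using hy) hc h0 h1
  obtain rfl : q₁ = q := by
    rcases Post.eq_third hpq hpν hqν q₁ with rfl | rfl | rfl
    · exact absurd (by simpa [a3] using a4.base _ hp) x.flip_ne
    · rfl
    · exact absurd (by rw [a3]) a4.ne
  obtain ⟨y, hy, hyx⟩ := a4.tail_eq_tower (r := p) a2 (by rw [a3]; exact hpν) hpq
  rw [hyx x hp] at hy
  rw [hy] at a1
  have hs : Step pre c₁ ⟨1, ν, q₁⟩ (Function.update c₁ 0 ⟨q₁, (c₁ 0).up.flip⟩) :=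
    ⟨0, rfl, by rw [a3], a4, rfl⟩
  exact ⟨l₁, l₂, _, a1, a2.step hs, by simp [a3], by rw [Fin.tail_update_zero, hy], a6, a7⟩

lemma len1000_succ (n : ℕ) : len1000 (n + 1) = 3 * len1000 n + 1 := rfl

lemma len909_succ (n : ℕ) : len909 (n + 1) = len727 n + 2 * len1000 n + 1 := by rw [len909]

lemma len727_add_two (n : ℕ) :
    len727 (n + 2) = len909 (n + 1) + 2 * len909 n + 2 * len1000 n + 3 := by rw [len727]

lemma len_le (n : ℕ) : len909 n ≤ len1000 n ∧ len727 n ≤ len1000 n := by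
  induction n using Nat.twoStepInduction with
  | zero => simp [len909, len727, len1000]
  | one => simp [len909, len727, len1000]
  | more n h1 h2 =>
    have := len1000_succ n
    have : len1000 (n + 2) = 3 * len1000 (n + 1) + 1 := len1000_succ (n + 1)
    have : len909 (n + 2) = len727 (n + 1) + 2 * len1000 (n + 1) + 1 := len909_succ (n + 1)
    have := len727_add_two n
    omega

/-- The lower bound, established in `far_neutral`, for the number of moves that bring a tower of `n`
disks from the neutral post, where it shows `x`, to the post of the same colour `x`. -/
def lenSame : ℕ → ℕ
  | 0 => 0
  | n + 1 => 2 * len1000 n + 2 * len909 n + 2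

/-- Between the neutral post and a coloured one, the transport that changes the colour of the tower
is the cheaper one; so a tower that goes from a coloured post to the neutral one and back should
change its colour on both ways. -/
lemma len909_le_lenSame (n : ℕ) : len909 n ≤ lenSame n := by
  cases n with
  | zero => simp [lenSame, len909]
  | succ n =>
    rw [lenSame, len909_succ]
    cases n with
    | zero => simp [len727]; omega
    | succ n =>
      have := len_le (n + 1)
      have := len1000_succ n
      have := len909_succ n
      omega

lemma len727_succ (n : ℕ) : len727 (n + 1) = len909 n + lenSame n + 1 := by
  cases n with
  | zero => simp [len727, len909, lenSame]
  | succ n => rw [len727_add_two, lenSame]; omega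

/-- The three kinds of transport in the presence of a neutral post `ν`, for which the lower bounds
have to be proved together: from the neutral post to the post of the same colour, from the neutral
post to the post of opposite colour, and between the two coloured posts. -/
lemma far_neutral {pre : PreColouring} {ν : Post} (hν : pre ν = none) (N : ℕ) :
    ∀ {p q : Post} {x : Colour}, pre p = some x → pre q = some x.flip →
      Far pre (tower N ν x) (tower N p x) (lenSame N) ∧
      Far pre (tower N ν x) (tower N q x.flip) (len909 N) ∧
      Far pre (tower N p x) (tower N q x.flip) (len727 N) := by
  induction N with
  | zero => intro p q x _ _; simp [Far, lenSame, len909, len727]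
  | succ N ih =>
    intro p q x hp hq
    have hpq : p ≠ q := by rintro rfl; exact x.flip_ne (by simpa [hp] using hq.symm)
    have hpν : p ≠ ν := by rintro rfl; simp [hp] at hν
    have hqν : q ≠ ν := by rintro rfl; simp [hq] at hν
    have hvν : ∀ N y, Valid pre (tower N ν y) := fun N y => valid_tower (by simp [hν])
    have hvp : ∀ N, Valid pre (tower N p x) := fun N => valid_tower (by simp [hp])
    have hvq : ∀ N, Valid pre (tower N q x.flip) := fun N => valid_tower (by simp [hq])
    have hp' : pre p = some x.flip.flip := by simpa using hp
    obtain ⟨ihs, iho, iht⟩ := ih hp hq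
    obtain ⟨jhs, jho, -⟩ := ih hq hp'
    rw [Colour.flip_flip] at jho
    have hle := len909_le_lenSame N
    have hlin := far_linear (pre := Function.update pre ν (some x)) (p := ν) (r := p) (q := q)
      (x := x) (by simp) (by simp [Function.update_of_ne hpν, hp])
      (by simp [Function.update_of_ne hqν, hq]) hpν.symm N
    refine ⟨fun ms h => ?_, fun ms h => ?_, fun ms h => ?_⟩
    · obtain ⟨l₁, l₂, c₁, a1, a2, a3, a4, a5, a6⟩ :=
        h.exists_leave_neutral hp hq hν (hvν _ x) rfl (by simp [tower, hpν])
      obtain ⟨y, l₃, l₄, b1, b2, b3⟩ := a5.exists_crossing hq hp' hν a2 (.inl a3)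
        (by simp [tower, hpq, hpν])
      have e1 := hlin _ a1
      rw [a4] at b1
      rw [lenSame]
      rcases x.eq_or_eq_flip y with rfl | rfl
      · have e2 := ihs.symm (hvp N) _ b1
        have e3 := ihs _ b2
        omega
      · have e2 := jho.symm (hvp N) _ b1
        have e3 := jho _ b2
        omega
    · obtain ⟨l₁, l₂, c₁, a1, a2, a3, a4, a5, a6⟩ :=
        h.exists_leave_neutral hp hq hν (hvν _ x) rfl (by simp [tower, hqν])
      obtain ⟨l₃, b1, b2⟩ := a5.tail
      have e1 := hlin _ a1
      rw [a4] at b1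
      have e2 := iht _ b1
      rw [len909_succ]
      omega
    · obtain ⟨y, l₁, l₂, b1, b2, b3⟩ := h.exists_crossing hp hq hν (hvp _) (.inl rfl)
        (by simp [tower, hpq.symm, hqν])
      rw [len727_succ]
      rcases x.eq_or_eq_flip y with rfl | rfl
      · have e2 := ihs.symm (hvp N) _ b1
        have e3 := iho _ b2
        omega
      · have e2 := jho.symm (hvp N) _ b1
        have e3 := jhs _ b2
        omega

/-! ### The algorithms solve the puzzle -/

/-- The tower `c` with its `n` smallest disks brought into the state `z`. -/
def setSmall {N : ℕ} (c : Tower N) (n : ℕ) (z : DiskState) : Tower N :=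
  fun k => if N ≤ k + n then z else c k

/-- The post `p` can take the `n` smallest disks showing the colour `x`: neither its pre-colouring
nor a larger disk on it shows the other colour. -/
def Accepts {N : ℕ} (pre : PreColouring) (c : Tower N) (n : ℕ) (p : Post) (x : Colour) : Prop :=
  (∀ y, pre p = some y → x = y) ∧ ∀ k : Fin N, k + n < N → (c k).post = p → (c k).up = x

/-- Disk number `N - n`, which is the largest of the `n + 1` smallest disks. -/
def nextDisk {N n : ℕ} (h : n + 1 ≤ N) : Fin N := ⟨N - (n + 1), by omega⟩

lemma setSmall_zero {N : ℕ} (c : Tower N) (z : DiskState) : setSmall c 0 z = c := by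
  funext k
  simp [setSmall, Nat.not_le.2 k.2]

lemma setSmall_self {N : ℕ} (c : Tower N) (z : DiskState) : setSmall c N z = fun _ => z := by
  funext k
  simp [setSmall]

lemma setSmall_succ {N n : ℕ} (h : n + 1 ≤ N) (c : Tower N) (z : DiskState) :
    setSmall c (n + 1) z = setSmall (Function.update c (nextDisk h) z) n z := by
  funext k
  by_cases hk : k = nextDisk h
  · subst hk
    simp only [setSmall, Function.update_self, ite_self, ite_eq_left_iff]
    intro h'
    simp only [nextDisk] at h'
    omega
  · have : k.val ≠ N - (n + 1) := fun e => hk (Fin.ext e)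
    simp only [setSmall, Function.update_of_ne hk]
    congr 1
    simp only [eq_iff_iff]
    omega

lemma Accepts.update {N n : ℕ} {pre : PreColouring} {c : Tower N} {p : Post} {x : Colour}
    (hp : Accepts pre c (n + 1) p x) (h : n + 1 ≤ N) {z : DiskState}
    (hz : z.post = p → z.up = x) : Accepts pre (Function.update c (nextDisk h) z) n p x := by
  refine ⟨hp.1, fun k hk hkp => ?_⟩
  by_cases hkn : k = nextDisk h
  · subst hkn
    simp only [Function.update_self] at hkp ⊢
    exact hz hkp
  · have : k.val ≠ N - (n + 1) := fun e => hkn (Fin.ext e)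
    simp only [Function.update_of_ne hkn] at hkp ⊢
    exact hp.2 k (by omega) hkp

/-- With the `n` smallest disks on the third post, the next larger disk can go to any post that
takes its colour. -/
lemma run_move {N n : ℕ} {pre : PreColouring} {c : Tower N} {s d i : Post} {x y z : Colour}
    (h : n + 1 ≤ N) (hxy : x.flip = y) (hsd : s ≠ d) (hsi : s ≠ i) (hdi : d ≠ i)
    (hd : Accepts pre c (n + 1) d y) {j : ℕ} (hj : j = N - n) :
    Run pre (setSmall (Function.update c (nextDisk h) ⟨s, x⟩) n ⟨i, z⟩) [⟨j, s, d⟩]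
      (setSmall (Function.update c (nextDisk h) ⟨d, y⟩) n ⟨i, z⟩) := by
  subst hxy
  have hval : (nextDisk h).val = N - (n + 1) := rfl
  have hc : ∀ w : DiskState,
      setSmall (Function.update c (nextDisk h) w) n ⟨i, z⟩ (nextDisk h) = w := fun w => by
    simp only [setSmall, Function.update_self]
    rw [if_neg (by omega)]
  have hsmall : ∀ l : Fin N, nextDisk h < l → ∀ w : DiskState,
      setSmall (Function.update c (nextDisk h) w) n ⟨i, z⟩ l = ⟨i, z⟩ := fun l hl w => by
    rw [Fin.lt_def] at hl
    simp only [setSmall]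
    rw [if_pos (by omega)]
  refine run_singleton.2 ⟨nextDisk h, by simp only [hj]; omega, by rw [hc],
    ⟨by rw [hc]; exact hsd, fun l hl => ?_, fun l hl => ?_, fun l hl => ?_, fun w hw => ?_⟩, ?_⟩
  · rw [hsmall l hl, hc]
    exact hsi.symm
  · rw [hsmall l hl]
    exact hdi.symm
  · rw [hc]
    rcases lt_trichotomy l (nextDisk h) with hlt | rfl | hgt
    · rw [Fin.lt_def] at hlt
      simp only [setSmall, if_neg (show ¬ N ≤ l.val + n by omega),
        Function.update_of_ne (Fin.ne_of_lt hlt)] at hl ⊢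
      exact hd.2 l (by omega) hl
    · rw [hc] at hl
      exact absurd hl hsd
    · rw [hsmall l hgt] at hl
      exact absurd hl hdi.symm
  · rw [hc]
    exact hd.1 w hw
  · funext l
    by_cases hl : l = nextDisk h
    · subst hl
      simp [hc]
    · simp only [setSmall, Function.update_of_ne hl]

/-- The "1000" algorithms are legal, and carry the `n` smallest disks from `s` to `d`, whenever the
posts accept these disks in the colours of the two coloured puzzles, up to an exchange of the
colours. -/
lemma run_1000 {N : ℕ} (pre : PreColouring) (n : ℕ) (hn : n ≤ N) :
    ∀ (c : Tower N) {s d i : Post} {x y : Colour}, x.flip = y → s ≠ d → s ≠ i → d ≠ i →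
      Accepts pre c n s x → Accepts pre c n d y →
      (Accepts pre c n i y →
        Run pre (setSmall c n ⟨s, x⟩) (SRBB1000 N n s d i) (setSmall c n ⟨d, y⟩)) ∧
      (Accepts pre c n i x →
        Run pre (setSmall c n ⟨s, x⟩) (SRRB1000 N n s d i) (setSmall c n ⟨d, y⟩)) := by
  induction n with
  | zero => intro c s d i x y _ _ _ _ _ _; simp [SRBB1000, SRRB1000, setSmall_zero, Run]
  | succ n ih =>
    intro c s d i x y hxy hsd hsi hdi hs hd
    have ih := ih (by omega)
    have hyx : y.flip = x := by rw [← hxy, Colour.flip_flip]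
    rw [setSmall_succ hn, setSmall_succ hn]
    have hs₁ := hs.update hn (z := ⟨s, x⟩) fun _ => rfl
    have hd₁ := hd.update hn (z := ⟨s, x⟩) fun e => absurd e hsd
    have hs₂ := hs.update hn (z := ⟨d, y⟩) fun e => absurd e hsd.symm
    have hd₂ := hd.update hn (z := ⟨d, y⟩) fun _ => rfl
    refine ⟨fun hi => ?_, fun hi => ?_⟩ <;>
      have hi₁ := hi.update hn (z := ⟨s, x⟩) fun e => absurd e hsi <;>
      have hi₂ := hi.update hn (z := ⟨d, y⟩) fun e => absurd e hdi
    · rw [SRBB1000]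
      exact ((((ih _ hxy hsi hsd hdi.symm hs₁ hi₁).1 hd₁).append
        (run_move hn hxy hsd hsi hdi hd (by omega))).append
        ((ih _ hyx hsi.symm hdi.symm hsd hi₂ hs₂).2 hd₂)).append
        ((ih _ hxy hsd hsi hdi hs₂ hd₂).1 hi₂)
    · rw [SRRB1000]
      exact ((((ih _ hxy hsd hsi hdi hs₁ hd₁).2 hi₁).append
        ((ih _ hyx hdi hsd.symm hsi.symm hd₁ hi₁).1 hs₁)).append
        (run_move hn hxy hsd hsi hdi hd (by omega))).append
        ((ih _ hxy hdi.symm hsi.symm hsd.symm hi₂ hd₂).2 hs₂)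

/-- The "909" and "727" algorithms are legal, and carry the `n` smallest disks from `s` to `d`,
whenever one post accepts these disks in both colours and the other two posts accept them in the
colours that the names of the algorithms say, up to an exchange of the colours. -/
lemma run_neutral {N : ℕ} (pre : PreColouring) (n : ℕ) (hn : n ≤ N) :
    ∀ (c : Tower N) {s d i : Post} {x y : Colour}, x.flip = y → s ≠ d → s ≠ i → d ≠ i →
      (Accepts pre c n s x → (∀ z, Accepts pre c n d z) → Accepts pre c n i y →
        Run pre (setSmall c n ⟨s, x⟩) (SRBN909 N n s d i) (setSmall c n ⟨d, y⟩)) ∧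
      ((∀ z, Accepts pre c n s z) → Accepts pre c n d y → Accepts pre c n i x →
        Run pre (setSmall c n ⟨s, x⟩) (SNRB909 N n s d i) (setSmall c n ⟨d, y⟩)) ∧
      (Accepts pre c n s x → Accepts pre c n d y → (∀ z, Accepts pre c n i z) →
        Run pre (setSmall c n ⟨s, x⟩) (SRNB727 N n s d i) (setSmall c n ⟨d, y⟩) ∧
        Run pre (setSmall c n ⟨s, x⟩) (SBNR727 N n s d i) (setSmall c n ⟨d, y⟩)) := by
  -- the "909" algorithms for `n + 1` disks call the "727" algorithms for `n` disks
  have step909 : ∀ n, n + 1 ≤ N →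
      (∀ (c : Tower N) {s d i : Post} {x y : Colour}, x.flip = y → s ≠ d → s ≠ i → d ≠ i →
        Accepts pre c n s x → Accepts pre c n d y → (∀ z, Accepts pre c n i z) →
        Run pre (setSmall c n ⟨s, x⟩) (SRNB727 N n s d i) (setSmall c n ⟨d, y⟩) ∧
        Run pre (setSmall c n ⟨s, x⟩) (SBNR727 N n s d i) (setSmall c n ⟨d, y⟩)) →
      ∀ (c : Tower N) {s d i : Post} {x y : Colour}, x.flip = y → s ≠ d → s ≠ i → d ≠ i →
        (Accepts pre c (n + 1) s x → (∀ z, Accepts pre c (n + 1) d z) →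
          Accepts pre c (n + 1) i y → Run pre (setSmall c (n + 1) ⟨s, x⟩)
            (SRBN909 N (n + 1) s d i) (setSmall c (n + 1) ⟨d, y⟩)) ∧
        ((∀ z, Accepts pre c (n + 1) s z) → Accepts pre c (n + 1) d y →
          Accepts pre c (n + 1) i x → Run pre (setSmall c (n + 1) ⟨s, x⟩)
            (SNRB909 N (n + 1) s d i) (setSmall c (n + 1) ⟨d, y⟩)) := by
    intro n hn ih c s d i x y hxy hsd hsi hdi
    have h1000 := run_1000 pre n (Nat.le_of_succ_le hn)
    have hyx : y.flip = x := by rw [← hxy, Colour.flip_flip]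
    rw [setSmall_succ hn, setSmall_succ hn]
    refine ⟨fun hs hd hi => ?_, fun hs hd hi => ?_⟩
    · have hs₁ := hs.update hn (z := ⟨s, x⟩) fun _ => rfl
      have hd₁ := fun z => (hd z).update hn (z := ⟨s, x⟩) fun e => absurd e hsd
      have hi₁ := hi.update hn (z := ⟨s, x⟩) fun e => absurd e hsi
      have hs₂ := hs.update hn (z := ⟨d, y⟩) fun e => absurd e hsd.symm
      have hd₂ := (hd y).update hn (z := ⟨d, y⟩) fun _ => rfl
      have hi₂ := hi.update hn (z := ⟨d, y⟩) fun e => absurd e hdi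
      rw [SRBN909]
      exact ((((ih _ hxy hsi hsd hdi.symm hs₁ hi₁ hd₁).1).append
        (run_move hn hxy hsd hsi hdi (hd y) (by omega))).append
        ((h1000 _ hyx hsi.symm hdi.symm hsd hi₂ hs₂).2 hd₂)).append
        ((h1000 _ hxy hsd hsi hdi hs₂ hd₂).1 hi₂)
    · have hs₁ := (hs x).update hn (z := ⟨s, x⟩) fun _ => rfl
      have hd₁ := hd.update hn (z := ⟨s, x⟩) fun e => absurd e hsd
      have hi₁ := hi.update hn (z := ⟨s, x⟩) fun e => absurd e hsi
      have hs₂ := fun z => (hs z).update hn (z := ⟨d, y⟩) fun e => absurd e hsd.symm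
      have hd₂ := hd.update hn (z := ⟨d, y⟩) fun _ => rfl
      have hi₂ := hi.update hn (z := ⟨d, y⟩) fun e => absurd e hdi
      rw [SNRB909]
      exact ((((h1000 _ hxy hsd hsi hdi hs₁ hd₁).2 hi₁).append
        ((h1000 _ hyx hdi hsd.symm hsi.symm hd₁ hi₁).1 hs₁)).append
        (run_move hn hxy hsd hsi hdi hd (by omega))).append
        (ih _ hxy hdi.symm hsi.symm hsd.symm hi₂ hd₂ hs₂).2
  induction n using Nat.twoStepInduction with
  | zero =>
    intro c s d i x y _ _ _ _
    simp [SRBN909, SNRB909, SRNB727, SBNR727, setSmall_zero, Run]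
  | one =>
    intro c s d i x y hxy hsd hsi hdi
    have h909 := step909 0 hn (by
      intro c s d i x y _ _ _ _
      simp [SRNB727, SBNR727, setSmall_zero, Run]) c hxy hsd hsi hdi
    refine ⟨h909.1, h909.2, fun hs hd hi => ?_⟩
    have hmove := run_move (z := x) hn hxy hsd hsi hdi hd (j := N + 1 - 1) (by omega)
    rw [setSmall_zero, setSmall_zero] at hmove
    rw [setSmall_succ hn, setSmall_succ hn, setSmall_zero, setSmall_zero, SRNB727, SBNR727]
    exact ⟨hmove, hmove⟩
  | more n ih0 ih1 =>
    intro c s d i x y hxy hsd hsi hdi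
    have hn₁ : n + 1 ≤ N := by omega
    have ih0 := ih0 (by omega)
    have ih1 := ih1 hn₁
    have h1000 := run_1000 pre n (by omega : n ≤ N)
    have hyx : y.flip = x := by rw [← hxy, Colour.flip_flip]
    have h909 := step909 (n + 1) hn
      (fun c {s d i x y} a b e f => (ih1 c a b e f).2.2) c hxy hsd hsi hdi
    refine ⟨h909.1, h909.2, fun hs hd hi => ?_⟩
    have hs₁ := hs.update hn (z := ⟨s, x⟩) fun _ => rfl
    have hd₁ := hd.update hn (z := ⟨s, x⟩) fun e => absurd e hsd
    have hi₁ := fun z => (hi z).update hn (z := ⟨s, x⟩) fun e => absurd e hsi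
    have hs₂ := hs.update hn (z := ⟨d, y⟩) fun e => absurd e hsd.symm
    have hd₂ := hd.update hn (z := ⟨d, y⟩) fun _ => rfl
    have hi₂ := fun z => (hi z).update hn (z := ⟨d, y⟩) fun e => absurd e hdi
    rw [setSmall_succ hn, setSmall_succ hn]
    constructor
    · -- disk `j` is on `d` when the pieces for the `n` smallest disks are run; `us`, `ud` and `ui`
      -- say which colours the posts accept then, for the various states `w` of disk `j + 1`
      have us := fun w e => hs₂.update hn₁ (z := w) e
      have ud := fun w e => hd₂.update hn₁ (z := w) e
      have ui := fun v w e => (hi₂ v).update hn₁ (z := w) e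
      have r₁ := (ih1 _ hxy hsi hsd hdi.symm).1 hs₁ hi₁ hd₁
      have r₂ := run_move (z := y) hn hxy hsd hsi hdi hd (j := N + 1 - (n + 2)) (by omega)
      have r₃ := (h1000 _ hyx hsi.symm hdi.symm hsd (ui y ⟨i, y⟩ fun _ => rfl)
        (us ⟨i, y⟩ fun e => absurd e hsi.symm)).2 (ud ⟨i, y⟩ fun e => absurd e hdi.symm)
      have r₄ := (h1000 _ hxy hsd hsi hdi (us ⟨i, y⟩ fun e => absurd e hsi.symm)
        (ud ⟨i, y⟩ fun e => absurd e hdi.symm)).1 (ui y ⟨i, y⟩ fun _ => rfl)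
      have r₅ := run_move (z := y) hn₁ hyx hsi.symm hdi.symm hsd hs₂
        (j := N + 1 - (n + 2) + 1) (by omega)
      have r₆ := (ih0 _ hyx hdi hsd.symm hsi.symm).1 (ud ⟨s, x⟩ fun e => absurd e hsd)
        (fun v => ui v ⟨s, x⟩ fun e => absurd e hsi) (us ⟨s, x⟩ fun _ => rfl)
      have r₇ := run_move (z := x) hn₁ hxy hsd hsi hdi hd₂
        (j := N + 1 - (n + 2) + 1) (by omega)
      have r₈ := (ih0 _ hxy hdi.symm hsi.symm hsd.symm).2.1
        (fun v => ui v ⟨d, y⟩ fun e => absurd e hdi) (ud ⟨d, y⟩ fun _ => rfl)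
        (us ⟨d, y⟩ fun e => absurd e hsd.symm)
      rw [SRNB727, setSmall_succ hn₁ (Function.update c (nextDisk hn) ⟨d, y⟩)]
      rw [setSmall_succ hn₁ (Function.update c (nextDisk hn) ⟨d, y⟩)] at r₂
      exact ((((((r₁.append r₂).append r₃).append r₄).append r₅).append r₆).append r₇).append r₈
    · -- the same, but with disk `j` still on `s`
      have us := fun w e => hs₁.update hn₁ (z := w) e
      have ud := fun w e => hd₁.update hn₁ (z := w) e
      have ui := fun v w e => (hi₁ v).update hn₁ (z := w) e
      have r₁ := (ih0 _ hxy hsi hsd hdi.symm).1 (us ⟨s, x⟩ fun _ => rfl)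
        (fun v => ui v ⟨s, x⟩ fun e => absurd e hsi) (ud ⟨s, x⟩ fun e => absurd e hsd)
      have r₂ := run_move (z := y) hn₁ hxy hsd hsi hdi hd₁
        (j := N + 1 - (n + 2) + 1) (by omega)
      have r₃ := (ih0 _ hyx hsi.symm hdi.symm hsd).2.1
        (fun v => ui v ⟨d, y⟩ fun e => absurd e hdi) (us ⟨d, y⟩ fun e => absurd e hsd.symm)
        (ud ⟨d, y⟩ fun _ => rfl)
      have r₄ := run_move (z := x) hn₁ hyx hdi hsd.symm hsi.symm (hi₁ x)
        (j := N + 1 - (n + 2) + 1) (by omega)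
      have r₅ := (h1000 _ hxy hsd hsi hdi (us ⟨i, x⟩ fun e => absurd e hsi.symm)
        (ud ⟨i, x⟩ fun e => absurd e hdi.symm)).2 (ui x ⟨i, x⟩ fun _ => rfl)
      have r₆ := (h1000 _ hyx hdi hsd.symm hsi.symm (ud ⟨i, x⟩ fun e => absurd e hdi.symm)
        (ui x ⟨i, x⟩ fun _ => rfl)).1 (us ⟨i, x⟩ fun e => absurd e hsi.symm)
      have r₇ := run_move (z := x) hn hxy hsd hsi hdi hd (j := N + 1 - (n + 2)) (by omega)
      have r₈ := (ih1 _ hxy hdi.symm hsi.symm hsd.symm).2.1 hi₂ hd₂ hs₂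
      rw [SBNR727, setSmall_succ hn₁ (Function.update c (nextDisk hn) ⟨s, x⟩)]
      rw [setSmall_succ hn₁ (Function.update c (nextDisk hn) ⟨s, x⟩)] at r₇
      exact ((((((r₁.append r₂).append r₃).append r₄).append r₅).append r₆).append r₇).append r₈

lemma setSmall_tower (N : ℕ) (c : Tower N) (p : Post) (x : Colour) :
    setSmall c N ⟨p, x⟩ = tower N p x := setSmall_self c _

/-- For the whole tower only the pre-colouring matters. -/
lemma accepts_all {N : ℕ} {pre : PreColouring} {p : Post} {x : Colour} (c : Tower N)
    (h : ∀ y, pre p = some y → x = y) : Accepts pre c N p x :=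
  ⟨h, fun k hk => absurd hk (by omega)⟩

lemma solves_909 (N : ℕ) :
    Solves RBN N (solution SRBN909 N) ∧ Solves NRB N (solution SNRB909 N) := by
  have h1 := (run_neutral RBN N le_rfl (start N) (s := .S) (d := .D) (i := .I) (x := .red)
    (y := .blue) rfl nofun nofun nofun).1 (accepts_all _ (by simp [RBN, preColouring]))
    (fun z => accepts_all _ (by simp [RBN, preColouring]))
    (accepts_all _ (by simp [RBN, preColouring]))
  have h2 := (run_neutral NRB N le_rfl (start N) (s := .S) (d := .D) (i := .I) (x := .red)
    (y := .blue) rfl nofun nofun nofun).2.1 (fun z => accepts_all _ (by simp [NRB, preColouring]))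
    (accepts_all _ (by simp [NRB, preColouring])) (accepts_all _ (by simp [NRB, preColouring]))
  rw [setSmall_tower, setSmall_tower] at h1 h2
  exact ⟨h1, h2⟩

lemma solves_727 (N : ℕ) :
    Solves RNB N (solution SRNB727 N) ∧ Solves RNB N (solution SBNR727 N) := by
  have h := (run_neutral RNB N le_rfl (start N) (s := .S) (d := .D) (i := .I) (x := .red)
    (y := .blue) rfl nofun nofun nofun).2.2 (accepts_all _ (by simp [RNB, preColouring]))
    (accepts_all _ (by simp [RNB, preColouring]))
    (fun z => accepts_all _ (by simp [RNB, preColouring]))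
  rw [setSmall_tower, setSmall_tower] at h
  exact h

/-! ### Counting moves -/

lemma length_1000 (N n : ℕ) (s d i : Post) :
    (SRBB1000 N n s d i).length = len1000 n ∧ (SRRB1000 N n s d i).length = len1000 n := by
  induction n generalizing s d i with
  | zero => simp [SRBB1000, SRRB1000, len1000]
  | succ n ih => simp [SRBB1000, SRRB1000, len1000, ih]; omega

lemma length_neutral (N n : ℕ) (s d i : Post) :
    (SRBN909 N n s d i).length = len909 n ∧ (SNRB909 N n s d i).length = len909 n ∧
    (SRNB727 N n s d i).length = len727 n ∧ (SBNR727 N n s d i).length = len727 n := by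
  induction n using Nat.twoStepInduction generalizing s d i with
  | zero => simp [SRBN909, SNRB909, SRNB727, SBNR727, len909, len727]
  | one =>
    simp [SRBN909, SNRB909, SRNB727, SBNR727, len909, len727, SRBB1000, SRRB1000, len1000]
  | more n ih0 ih1 =>
    rw [SRBN909.eq_2 N s d i (n + 1), SNRB909.eq_2 N s d i (n + 1), SRNB727.eq_3, SBNR727.eq_3,
      len727_add_two, show len909 (n + 2) = _ from len909_succ (n + 1)]
    simp only [List.length_append, List.length_singleton, ih0, ih1, length_1000]
    omega

/-- The number of moves of the `r`-th largest disk in the "1000" algorithms, with the value `0` for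
the disks that stay, which come under `r = 0`. -/
def cnt1000 : ℕ → ℕ
  | 0 => 0
  | 1 => 1
  | r + 2 => 3 * cnt1000 (r + 1)

mutual

/-- The number of moves of the `r`-th largest disk in the "909" algorithms. -/
def cnt909 : ℕ → ℕ
  | 0 => 0
  | 1 => 1
  | r + 2 => cnt727 (r + 1) + 2 * cnt1000 (r + 1)

/-- The number of moves of the `r`-th largest disk in the "727" algorithms. -/
def cnt727 : ℕ → ℕ
  | 0 => 0
  | 1 => 1
  | 2 => 3
  | r + 3 => cnt909 (r + 2) + 2 * cnt909 (r + 1) + 2 * cnt1000 (r + 1)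

end

lemma cnt909_add_two (r : ℕ) : cnt909 (r + 2) = cnt727 (r + 1) + 2 * cnt1000 (r + 1) := by
  rw [cnt909]

lemma cnt727_add_three (r : ℕ) :
    cnt727 (r + 3) = cnt909 (r + 2) + 2 * cnt909 (r + 1) + 2 * cnt1000 (r + 1) := by
  rw [cnt727]

lemma diskMoves_append (a b : List Move) (k : ℕ) :
    diskMoves (a ++ b) k = diskMoves a k + diskMoves b k := List.countP_append

lemma diskMoves_singleton (j k : ℕ) (p q : Post) :
    diskMoves [⟨j, p, q⟩] k = if j = k then 1 else 0 := by
  simp [diskMoves, List.countP_cons]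

/-- Disk `k` of `N` is the `(k + n - N)`-th largest of the `n` smallest disks, or, if the truncated
difference is `0`, not one of them. -/
lemma diskMoves_1000 {N n k : ℕ} (hn : n ≤ N) (hk : k ≤ N) (s d i : Post) :
    diskMoves (SRBB1000 N n s d i) k = cnt1000 (k + n - N) ∧
    diskMoves (SRRB1000 N n s d i) k = cnt1000 (k + n - N) := by
  induction n generalizing s d i with
  | zero => simp [SRBB1000, SRRB1000, diskMoves, Nat.sub_eq_zero_of_le hk, cnt1000]
  | succ n ih =>
    have ih := ih (by omega)
    simp only [SRBB1000, SRRB1000, diskMoves_append, diskMoves_singleton, ih]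
    obtain ⟨r, hr⟩ : ∃ r, k + (n + 1) - N = r := ⟨_, rfl⟩
    have hr' : k + n - N = r - 1 := by omega
    rw [hr, hr']
    match r, hr with
    | 0, hr => rw [if_neg (by omega)]; simp [cnt1000]
    | 1, hr => rw [if_pos (by omega)]; simp [cnt1000]
    | r + 2, hr => rw [if_neg (by omega)]; simp [cnt1000]; omega

lemma diskMoves_neutral {N n k : ℕ} (hn : n ≤ N) (hk : k ≤ N) (s d i : Post) :
    diskMoves (SRBN909 N n s d i) k = cnt909 (k + n - N) ∧
    diskMoves (SNRB909 N n s d i) k = cnt909 (k + n - N) ∧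
    diskMoves (SRNB727 N n s d i) k = cnt727 (k + n - N) ∧
    diskMoves (SBNR727 N n s d i) k = cnt727 (k + n - N) := by
  induction n using Nat.twoStepInduction generalizing s d i with
  | zero =>
    simp [SRBN909, SNRB909, SRNB727, SBNR727, diskMoves, Nat.sub_eq_zero_of_le hk, cnt909, cnt727]
  | one =>
    simp only [SRBN909, SNRB909, SRNB727, SBNR727, SRBB1000, SRRB1000, List.append_nil,
      List.nil_append, diskMoves_singleton]
    rcases (by omega : k < N ∨ k = N) with h | rfl
    · rw [if_neg (by omega), Nat.sub_eq_zero_of_le (by omega)]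
      simp [cnt909, cnt727]
    · simp [cnt909, cnt727]
  | more n ih0 ih1 =>
    have ih0 := ih0 (by omega)
    have ih1 := ih1 (by omega)
    have h1000 := fun s d i => diskMoves_1000 (n := n) (by omega) hk s d i
    have h1000' := fun s d i => diskMoves_1000 (n := n + 1) (by omega) hk s d i
    rw [SRBN909.eq_2 N s d i (n + 1), SNRB909.eq_2 N s d i (n + 1), SRNB727.eq_3, SBNR727.eq_3]
    simp only [diskMoves_append, diskMoves_singleton, ih0, ih1, h1000, h1000']
    obtain ⟨r, hr⟩ : ∃ r, k + (n + 2) - N = r := ⟨_, rfl⟩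
    have hr₀ : k + n - N = r - 2 := by omega
    have hr₁ : k + (n + 1) - N = r - 1 := by omega
    have e₁ : N + 1 - (n + 2) = k ↔ r = 1 := by omega
    have e₂ : N + 1 - (n + 2) + 1 = k ↔ r = 2 := by omega
    simp only [hr, hr₀, hr₁, e₁, e₂]
    match r with
    | 0 => simp [cnt1000, cnt909, cnt727]
    | 1 => simp [cnt1000, cnt909, cnt727]
    | 2 => simp [cnt1000, cnt909, cnt727]
    | r + 3 =>
      have h : cnt909 (r + 3) = cnt727 (r + 2) + 2 * cnt1000 (r + 2) := cnt909_add_two (r + 1)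
      rw [cnt727_add_three, h, show r + 3 - 1 = r + 2 from rfl, show r + 3 - 2 = r + 1 from rfl,
        if_neg (by omega), if_neg (by omega)]
      omega

lemma S1000_eq (N : ℕ) : S1000 N = len1000 N := (length_1000 ..).1

lemma S909_eq (N : ℕ) : S909 N = len909 N := (length_neutral ..).1

lemma S727_eq (N : ℕ) : S727 N = len727 N := (length_neutral ..).2.2.1

lemma P1000_eq (k : ℕ) : P1000 k = cnt1000 k := by
  have h := (diskMoves_1000 (N := k) (n := k) (k := k) le_rfl le_rfl .S .D .I).1
  rwa [Nat.add_sub_cancel] at h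

lemma P909_eq (k : ℕ) : P909 k = cnt909 k := by
  have h := (diskMoves_neutral (N := k) (n := k) (k := k) le_rfl le_rfl .S .D .I).1
  rwa [Nat.add_sub_cancel] at h

lemma P727_eq (k : ℕ) : P727 k = cnt727 k := by
  have h := (diskMoves_neutral (N := k) (n := k) (k := k) le_rfl le_rfl .S .D .I).2.2.1
  rwa [Nat.add_sub_cancel] at h

/-! ### Optimality -/

lemma isOptimal_909 (N : ℕ) :
    IsOptimal RBN N (solution SRBN909 N) ∧ IsOptimal NRB N (solution SNRB909 N) := by
  refine ⟨⟨(solves_909 N).1, fun ms h => ?_⟩, ⟨(solves_909 N).2, fun ms h => ?_⟩⟩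
  · have hfar := (far_neutral (pre := RBN) (ν := .D) rfl N (p := .I) (q := .S) (x := .blue)
      rfl rfl).2.1
    exact (length_neutral ..).1 ▸
      hfar.symm (valid_tower (by simp [RBN, preColouring, Colour.flip])) ms h
  · exact (length_neutral ..).2.1 ▸ (far_neutral (pre := NRB) (ν := .S) rfl N (p := .I) (q := .D)
      (x := .red) rfl rfl).2.1 ms h

lemma isOptimal_727 (N : ℕ) :
    IsOptimal RNB N (solution SRNB727 N) ∧ IsOptimal RNB N (solution SBNR727 N) := by
  have hfar := (far_neutral (pre := RNB) (ν := .I) rfl N (p := .S) (q := .D) (x := .red)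
    rfl rfl).2.2
  exact ⟨⟨(solves_727 N).1, fun ms h => (length_neutral ..).2.2.1 ▸ hfar ms h⟩,
    ⟨(solves_727 N).2, fun ms h => (length_neutral ..).2.2.2 ▸ hfar ms h⟩⟩

/-! ### Asymptotics -/

/-- The linear recurrences behind the "909" and "727" sequences: `5 c / 11 * 3 ^ n` and
`4 c / 11 * 3 ^ n` satisfy them up to the constant `t`, and the errors `g n - 5 c / 11 * 3 ^ n` and
`h n - 4 c / 11 * 3 ^ n` are of the order of `2 ^ n` only. -/
lemma tendsto_div_three_pow {g h : ℕ → ℝ} {c t : ℝ} (hg : ∀ n, g (n + 1) = h n + c * 3 ^ n)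
    (hh : ∀ n, h (n + 2) = g (n + 1) + 2 * g n + c * 3 ^ n + t) :
    Tendsto (fun n => g n / 3 ^ n) atTop (𝓝 (5 * c / 11)) ∧
    Tendsto (fun n => h n / 3 ^ n) atTop (𝓝 (4 * c / 11)) := by
  obtain ⟨α, hα⟩ : ∃ α : ℕ → ℝ, ∀ n, α n = g n - 5 * c / 11 * 3 ^ n := ⟨_, fun _ => rfl⟩
  obtain ⟨β, hβ⟩ : ∃ β : ℕ → ℝ, ∀ n, β n = h n - 4 * c / 11 * 3 ^ n := ⟨_, fun _ => rfl⟩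
  have hαs : ∀ n, α (n + 1) = β n := fun n => by rw [hα, hβ, hg, pow_succ]; ring
  have hβs : ∀ n, β (n + 2) = α (n + 1) + 2 * α n + t := fun n => by
    rw [hα, hα, hβ, hh, pow_succ, pow_succ]; ring
  obtain ⟨K, hK⟩ : ∃ K, K = |α 0| + |β 0| + |β 1| + |t| := ⟨_, rfl⟩
  have h0 := abs_nonneg (α 0)
  have h1 := abs_nonneg (β 0)
  have h2 := abs_nonneg (β 1)
  have h3 := abs_nonneg t
  have hbound : ∀ n, |α n| ≤ K * 2 ^ n ∧ |β n| ≤ K * 2 ^ n := by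
    intro n
    induction n using Nat.twoStepInduction with
    | zero => constructor <;> simp <;> linarith
    | one => rw [hαs]; constructor <;> simp <;> linarith
    | more n ih0 ih1 =>
      have hpow : (1 : ℝ) ≤ 2 ^ n := one_le_pow₀ (by norm_num)
      have hK2 : |t| ≤ K * 2 ^ n := by nlinarith
      rw [hαs, hβs, hαs]
      rw [pow_succ] at ih1
      rw [pow_succ, pow_succ]
      refine ⟨by linarith [abs_nonneg (β (n + 1))], ?_⟩
      calc |β n + 2 * α n + t| ≤ |β n| + |2 * α n| + |t| := abs_add_three ..
        _ = |β n| + 2 * |α n| + |t| := by rw [abs_mul, abs_two]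
        _ ≤ K * (2 ^ n * 2 * 2) := by linarith
  have hzero : ∀ γ : ℕ → ℝ, (∀ n, |γ n| ≤ K * 2 ^ n) →
      Tendsto (fun n => γ n / 3 ^ n) atTop (𝓝 0) := by
    intro γ hγ
    have hlim : Tendsto (fun n : ℕ => K * (2 / 3 : ℝ) ^ n) atTop (𝓝 0) := by
      simpa using (tendsto_pow_atTop_nhds_zero_of_lt_one (r := (2 / 3 : ℝ)) (by norm_num)
        (by norm_num)).const_mul K
    refine squeeze_zero_norm (fun n => ?_) hlim
    rw [Real.norm_eq_abs, abs_div, abs_of_pos (by positivity : (0 : ℝ) < 3 ^ n), div_pow,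
      ← mul_div_assoc]
    gcongr
    exact hγ n
  have hα' := (hzero α fun n => (hbound n).1).add_const (5 * c / 11)
  have hβ' := (hzero β fun n => (hbound n).2).add_const (4 * c / 11)
  rw [zero_add] at hα' hβ'
  refine ⟨hα'.congr fun n => ?_, hβ'.congr fun n => ?_⟩
  · rw [hα]
    field_simp
    ring
  · rw [hβ]
    field_simp
    ring

lemma two_mul_len1000 (n : ℕ) : (2 * len1000 n : ℝ) = 3 ^ n - 1 := by
  induction n with
  | zero => simp [len1000]
  | succ n ih => rw [len1000_succ, pow_succ]; push_cast; linarith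

lemma cnt1000_succ (n : ℕ) : cnt1000 (n + 1) = 3 ^ n := by
  induction n with
  | zero => rfl
  | succ n ih => rw [cnt1000, ih, pow_succ]; ring

lemma tendsto_len :
    Tendsto (fun n => (len909 n : ℝ) / len1000 n) atTop (𝓝 (10 / 11)) ∧
    Tendsto (fun n => (len727 n : ℝ) / len1000 n) atTop (𝓝 (8 / 11)) := by
  obtain ⟨h909, h727⟩ := tendsto_div_three_pow (g := fun n => (len909 n : ℝ))
    (h := fun n => (len727 n : ℝ)) (c := 1) (t := 2)
    (fun n => by
      have := two_mul_len1000 n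
      simp only [len909_succ]
      push_cast
      linarith)
    (fun n => by
      have := two_mul_len1000 n
      simp only [len727_add_two]
      push_cast
      linarith)
  have h1000 : Tendsto (fun n => (len1000 n : ℝ) / 3 ^ n) atTop (𝓝 (1 / 2)) := by
    have h := ((tendsto_pow_atTop_nhds_zero_of_lt_one (r := (1 / 3 : ℝ)) (by norm_num)
      (by norm_num)).const_sub 1).div_const 2
    rw [sub_zero] at h
    refine h.congr fun n => ?_
    have := two_mul_len1000 n
    rw [show (len1000 n : ℝ) = (3 ^ n - 1) / 2 by linarith, div_pow, one_pow]
    field_simp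
  have hdiv : ∀ (u : ℕ → ℝ) (l : ℝ), Tendsto (fun n => u n / 3 ^ n) atTop (𝓝 l) →
      Tendsto (fun n => u n / len1000 n) atTop (𝓝 (l / (1 / 2))) := fun u l hu =>
    (hu.div h1000 (by norm_num)).congr fun n =>
      div_div_div_cancel_right₀ (by positivity) _ _
  constructor
  · convert hdiv _ _ h909 using 2
    norm_num
  · convert hdiv _ _ h727 using 2
    norm_num

lemma tendsto_cnt :
    Tendsto (fun n => (cnt909 n : ℝ) / cnt1000 n) atTop (𝓝 (10 / 11)) ∧
    Tendsto (fun n => (cnt727 n : ℝ) / cnt1000 n) atTop (𝓝 (8 / 11)) := by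
  obtain ⟨h909, h727⟩ := tendsto_div_three_pow (g := fun n => (cnt909 (n + 1) : ℝ))
    (h := fun n => (cnt727 (n + 1) : ℝ)) (c := 2) (t := 0)
    (fun n => by simp only [cnt909_add_two, cnt1000_succ]; push_cast; ring)
    (fun n => by simp only [cnt727_add_three, cnt1000_succ]; push_cast; ring)
  constructor
  · refine (tendsto_add_atTop_iff_nat 1).1 ?_
    convert h909 using 2
    · rw [cnt1000_succ]; push_cast; rfl
    · norm_num
  · refine (tendsto_add_atTop_iff_nat 1).1 ?_
    convert h727 using 2
    · rw [cnt1000_succ]; push_cast; rfl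
    · norm_num

end MToH

open MToH in
theorem mainTheorem3 :
    -- optimality of the two "909" algorithms and of the two "727" algorithms
    (∀ N : ℕ,
      MToH.IsOptimal MToH.RBN N (MToH.solution MToH.SRBN909 N) ∧
      MToH.IsOptimal MToH.NRB N (MToH.solution MToH.SNRB909 N) ∧
      MToH.IsOptimal MToH.RNB N (MToH.solution MToH.SRNB727 N) ∧
      MToH.IsOptimal MToH.RNB N (MToH.solution MToH.SBNR727 N)) ∧
    -- the total numbers of moves are the same for both members of a pair
    (∀ N : ℕ,
      (MToH.solution MToH.SRRB1000 N).length = MToH.S1000 N ∧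
      (MToH.solution MToH.SNRB909 N).length = MToH.S909 N ∧
      (MToH.solution MToH.SBNR727 N).length = MToH.S727 N) ∧
    -- the numbers of moves of disk `k` are the same for both members of a pair and do not
    -- depend on the number of disks
    (∀ N k : ℕ, 1 ≤ k → k ≤ N →
      MToH.diskMoves (MToH.solution MToH.SRBB1000 N) k = MToH.P1000 k ∧
      MToH.diskMoves (MToH.solution MToH.SRRB1000 N) k = MToH.P1000 k ∧
      MToH.diskMoves (MToH.solution MToH.SRBN909 N) k = MToH.P909 k ∧
      MToH.diskMoves (MToH.solution MToH.SNRB909 N) k = MToH.P909 k ∧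
      MToH.diskMoves (MToH.solution MToH.SRNB727 N) k = MToH.P727 k ∧
      MToH.diskMoves (MToH.solution MToH.SBNR727 N) k = MToH.P727 k) ∧
    -- recurrence relations for the "909" pair
    (MToH.S909 1 = 1 ∧
      ∀ N : ℕ, MToH.S909 (N + 1) = MToH.S727 N + 2 * MToH.S1000 N + 1) ∧
    (MToH.P909 1 = 1 ∧
      ∀ k : ℕ, 1 ≤ k → MToH.P909 (k + 1) = MToH.P727 k + 2 * MToH.P1000 k) ∧
    -- recurrence relations for the "727" pair
    (MToH.S727 1 = 1 ∧ MToH.S727 2 = 4 ∧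
      ∀ N : ℕ, 1 ≤ N →
        MToH.S727 (N + 1) =
          MToH.S909 N + 2 * MToH.S909 (N - 1) + 2 * MToH.S1000 (N - 1) + 3) ∧
    (MToH.P727 1 = 1 ∧ MToH.P727 2 = 3 ∧
      ∀ k : ℕ, 2 ≤ k →
        MToH.P727 (k + 1) =
          MToH.P909 k + 2 * MToH.P909 (k - 1) + 2 * MToH.P1000 (k - 1)) ∧
    -- duration limits
    Tendsto (fun N : ℕ => (MToH.S909 N : ℝ) / (MToH.S1000 N : ℝ)) atTop (𝓝 (10 / 11)) ∧
    Tendsto (fun N : ℕ => (MToH.S727 N : ℝ) / (MToH.S1000 N : ℝ)) atTop (𝓝 (8 / 11)) ∧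
    Tendsto (fun k : ℕ => (MToH.P909 k : ℝ) / (MToH.P1000 k : ℝ)) atTop (𝓝 (10 / 11)) ∧
    Tendsto (fun k : ℕ => (MToH.P727 k : ℝ) / (MToH.P1000 k : ℝ)) atTop (𝓝 (8 / 11)) := by
  refine ⟨fun N => ⟨(isOptimal_909 N).1, (isOptimal_909 N).2, isOptimal_727 N⟩, fun N => ?_,
    fun N k _ hk => ?_, ⟨?_, fun N => ?_⟩, ⟨?_, fun k hk => ?_⟩, ⟨?_, ?_, fun N hN => ?_⟩,
    ⟨?_, ?_, fun k hk => ?_⟩, ?_⟩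
  · rw [S1000_eq, S909_eq, S727_eq]
    exact ⟨(length_1000 ..).2, (length_neutral ..).2.1, (length_neutral ..).2.2.2⟩
  · have h1 := diskMoves_1000 le_rfl hk .S .D .I
    have h2 := diskMoves_neutral le_rfl hk .S .D .I
    rw [Nat.add_sub_cancel] at h1 h2
    rw [P1000_eq, P909_eq, P727_eq]
    exact ⟨h1.1, h1.2, h2⟩
  · rw [S909_eq]; simp [len909, len727, len1000]
  · rw [S909_eq, S727_eq, S1000_eq, len909_succ]
  · rw [P909_eq, cnt909]
  · obtain ⟨k, rfl⟩ := Nat.exists_eq_add_of_le' hk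
    rw [P909_eq, P727_eq, P1000_eq, cnt909_add_two]
  · rw [S727_eq, len727]
  · rw [S727_eq]; simp [len727, len909, len1000]
  · obtain ⟨N, rfl⟩ := Nat.exists_eq_add_of_le' hN
    rw [S727_eq, S909_eq, S909_eq, S1000_eq, Nat.add_sub_cancel, len727_add_two]
  · rw [P727_eq, cnt727]
  · rw [P727_eq, cnt727]
  · obtain ⟨k, rfl⟩ := Nat.exists_eq_add_of_le' hk
    rw [P727_eq, P909_eq, P909_eq, P1000_eq]
    exact cnt727_add_three k
  · simp only [S1000_eq, S909_eq, S727_eq, P1000_eq, P909_eq, P727_eq]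
    exact ⟨tendsto_len.1, tendsto_len.2, tendsto_cnt.1, tendsto_cnt.2⟩
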